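/- For a compact set $K\subseteq\mathbb{C}^N$ let $B(K)$ denote the closure, in the supremum norm on $K$, of the algebra of complex polynomial functions on $K$ inside $C(K,\mathbb{C})$; if $K\subseteq L$, restriction of functions gives a morphism $B(L)\to B(K)$. Let $n,k\ge 0$ be integers, let $R>0$ and $c\in\mathbb{R}$, and let $\alpha\colon\mathbb{C}^n\to\mathbb{R}$ be an $\mathbb{R}$-linear functional. For an integer $m\ge 1$ put \[ W_m=\{(z,w)\in\mathbb{C}^{n+k} : |z_1|,\dots,|z_n|\le R+\tfrac1m \text{ and } |w_1|,\dots,|w_k|\le 1+\tfrac1m\}, \] \[ W_m'=\{(z,w)\in W_m : \alpha(z)\le c+\tfrac1m\},\qquad W_m''=\{(z,w)\in W_m : \alpha(z)\ge c-\tfrac1m\}. \] Then, for every $m\ge 1$, \[ \operatorname{Image}\bigl[B(W_m')\to B(W_m'\cap W_m'')\bigr]+\operatorname{Image}\bigl[B(W_m'')\to B(W_m'\cap W_m'')\bigr]=B(W_m'\cap W_m''), \] where the morphisms are restrictions: every $f\in B(W_m'\cap W_m'')$ is of the form $f'|_{W_m'\cap W_m''}+f''|_{W_m'\cap W_m''}$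 with $f'\in B(W_m')$ and $f''\in B(W_m'')$. -/

import Mathlib

open TopologicalSpace

noncomputable section

/-- The `i`-th coordinate function on `K`. -/
def coordFn {ι : Type*} (K : Compacts (ι → ℂ)) (i : ι) : C(K, ℂ) :=
  ⟨fun x => x.1 i, (continuous_apply i).comp continuous_subtype_val⟩

/-- The polynomial functions on a compact set `K` in `ℂ^ι`, as a subalgebra of `C(K, ℂ)`. -/
def polyFunctions {ι : Type*} (K : Compacts (ι → ℂ)) : Subalgebra ℂ C(K, ℂ) :=
  (MvPolynomial.aeval (R := ℂ) (S₁ := C(K, ℂ))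
    (coordFn K)).range

/-- `f` is a polynomial function on `K` iff it is given by evaluating a polynomial. -/
theorem mem_polyFunctions {ι : Type*} (K : Compacts (ι → ℂ)) (f : C(K, ℂ)) :
    f ∈ polyFunctions K ↔ ∃ p : MvPolynomial ι ℂ, ∀ x : K, f x = MvPolynomial.eval x.1 p := by
  have key : ∀ (p : MvPolynomial ι ℂ) (x : K),
      (MvPolynomial.aeval (R := ℂ) (S₁ := C(K, ℂ))
        (coordFn K) p) x
        = MvPolynomial.eval x.1 p := by
    intro p x
    induction p using MvPolynomial.induction_on with
    | C a => simp
    | add p q hp hq => simp [hp, hq]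
    | mul_X p i hp => simp [hp, coordFn]
  constructor
  · rintro ⟨p, rfl⟩
    exact ⟨p, fun x => key p x⟩
  · rintro ⟨p, hp⟩
    exact ⟨p, ContinuousMap.ext fun x => (key p x).trans (hp x).symm⟩

/-- The uniform algebra `B(K)`: the closure, in the supremum norm on `C(K, ℂ)`, of the algebra of
polynomial functions on the compact set `K`. -/
def uniformAlg {ι : Type*} (K : Compacts (ι → ℂ)) : Subalgebra ℂ C(K, ℂ) :=
  (polyFunctions K).topologicalClosure

/-- Restriction of continuous functions from `L` to a smaller compact set `K`. -/
def restrictC {ι : Type*} {K L : Compacts (ι → ℂ)} (h : K ≤ L) : C(L, ℂ) →ₐ[ℂ] C(K, ℂ) :=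
  ContinuousMap.compRightAlgHom ℂ ℂ
    (⟨fun x => ⟨x.1, h x.2⟩, by fun_prop⟩ : C(K, L))

theorem restrictC_apply {ι : Type*} {K L : Compacts (ι → ℂ)} (h : K ≤ L) (f : C(L, ℂ)) (x : K) :
    restrictC h f x = f ⟨x.1, h x.2⟩ := rfl

theorem restrictC_mem {ι : Type*} {K L : Compacts (ι → ℂ)} (h : K ≤ L) (f : C(L, ℂ))
    (hf : f ∈ uniformAlg L) : restrictC h f ∈ uniformAlg K := by
  have hc : Continuous (restrictC h) :=
    ContinuousMap.continuous_precomp (⟨fun x => ⟨x.1, h x.2⟩, by fun_prop⟩ : C(K, L))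
  refine map_mem_closure hc hf ?_
  intro g hg
  obtain ⟨p, hp⟩ := (mem_polyFunctions L g).1 hg
  exact (mem_polyFunctions K _).2 ⟨p, fun x => hp ⟨x.1, h x.2⟩⟩

/-- The restriction morphism `B(L) → B(K)` for `K ⊆ L`. -/
def uniformRestrict {ι : Type*} {K L : Compacts (ι → ℂ)} (h : K ≤ L) :
    uniformAlg L →ₐ[ℂ] uniformAlg K :=
  ((restrictC h).comp (uniformAlg L).val).codRestrict (uniformAlg K)
    (fun f => restrictC_mem h f.1 f.2)

theorem uniformRestrict_apply {ι : Type*} {K L : Compacts (ι → ℂ)} (h : K ≤ L)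
    (f : uniformAlg L) (x : K) : (uniformRestrict h f).1 x = f.1 ⟨x.1, h x.2⟩ := rfl

/-- The compact polydisk `W_m` in `ℂ^{n+k}`; the points are `(z, w)` with
`z i = x (Sum.inl i)` and `w j = x (Sum.inr j)`. -/
def polydisk (n k : ℕ) (R : ℝ) (m : ℕ) : Compacts (Fin n ⊕ Fin k → ℂ) where
  carrier := {x | (∀ i, ‖x (Sum.inl i)‖ ≤ R + 1 / (m : ℝ)) ∧
    ∀ j, ‖x (Sum.inr j)‖ ≤ 1 + 1 / (m : ℝ)}
  isCompact' := by
    have : {x : Fin n ⊕ Fin k → ℂ | (∀ i, ‖x (Sum.inl i)‖ ≤ R + 1 / (m : ℝ)) ∧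
        ∀ j, ‖x (Sum.inr j)‖ ≤ 1 + 1 / (m : ℝ)} =
        Set.univ.pi fun s => Metric.closedBall (0 : ℂ)
          (Sum.elim (fun _ => R + 1 / (m : ℝ)) (fun _ => 1 + 1 / (m : ℝ)) s) := by
      ext x
      simp [Set.mem_pi]
    rw [this]
    exact isCompact_univ_pi fun _ => isCompact_closedBall _ _

theorem continuous_functional {n k : ℕ} (α : (Fin n → ℂ) →ₗ[ℝ] ℝ) :
    Continuous fun x : Fin n ⊕ Fin k → ℂ => α fun i => x (Sum.inl i) :=
  α.continuous_of_finiteDimensional.comp (by fun_prop)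

/-- `W_m' = {(z, w) ∈ W_m : α(z) ≤ c + 1/m}`. -/
def lowerSlab (n k : ℕ) (R : ℝ) (α : (Fin n → ℂ) →ₗ[ℝ] ℝ) (c : ℝ) (m : ℕ) :
    Compacts (Fin n ⊕ Fin k → ℂ) where
  carrier := {x | x ∈ polydisk n k R m ∧ α (fun i => x (Sum.inl i)) ≤ c + 1 / (m : ℝ)}
  isCompact' := (polydisk n k R m).isCompact.inter_right
    (isClosed_le (continuous_functional α) continuous_const)

/-- `W_m'' = {(z, w) ∈ W_m : α(z) ≥ c - 1/m}`. -/
def upperSlab (n k : ℕ) (R : ℝ) (α : (Fin n → ℂ) →ₗ[ℝ] ℝ) (c : ℝ) (m : ℕ) :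
    Compacts (Fin n ⊕ Fin k → ℂ) where
  carrier := {x | x ∈ polydisk n k R m ∧ c - 1 / (m : ℝ) ≤ α (fun i => x (Sum.inl i))}
  isCompact' := (polydisk n k R m).isCompact.inter_right
    (isClosed_le continuous_const (continuous_functional α))

end

/-! The images together are everything once polynomials split with bounds: if `‖p‖ ≤ η` on the slab
`a ≤ β ≤ b`, there must be a polynomial `q` with `q = O(η)` on `β ≤ b` and `p - q = O(η)` on `β ≥
a`, the constant being independent of `p`. Successive approximation in Banach spaces
(`controlled_closure_of_complete`) then reaches the whole closure of the polynomials.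

The smooth candidate for `q` is `p · χ(β)`, with `χ` a cutoff rising from 0 to 1 between `a` and
`b`. It is not holomorphic, but its antiholomorphic derivatives are constants times `p · χ⁽ᵏ⁾(β)`,
`k ≥ 1`. They live on the slab, so they are `O(η)` however large `p` is elsewhere. Replacing `χ` by
a polynomial `h` close to it in `C^d` makes `p · h(β)` a polynomial in `z` and `conj z`. Applying
the Cauchy integral in each variable in turn yields a holomorphic polynomial `q`, and
`exists_bound_iteratedCauchyProj_sub` bounds the change by these derivatives alone. -/

noncomputable section

/-! ### One variable: a Cauchy–Pompeiu estimate. -/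

open MeasureTheory intervalIntegral ComplexConjugate in
/-- The Cauchy transform of the boundary values of a differentiable function on a disk differs
from the function by at most `2 r` times the supremum of the antiholomorphic derivative. -/
theorem norm_cauchyIntegral_sub_le_of_lt {g g₁ g₂ : ℂ → ℂ} (h₁ : Continuous g₁)
    (h₂ : Continuous g₂)
    (hg : ∀ x, HasFDerivAt g (g₁ x • ContinuousLinearMap.id ℝ ℂ +
      g₂ x • (Complex.conjCLE : ℂ →L[ℝ] ℂ)) x)
    {r M : ℝ} {z : ℂ} (hz : ‖z‖ < r) (hM : ∀ ζ : ℂ, ‖ζ‖ ≤ r → ‖g₂ ζ‖ ≤ M) :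
    ‖(2 * Real.pi * Complex.I : ℂ)⁻¹ * (∮ ζ in C(0, r), (ζ - z)⁻¹ * g ζ) - g z‖ ≤ 2 * r * M := by
  have hr : 0 < r := (norm_nonneg z).trans_lt hz
  set η : ℝ → ℂ := fun θ => circleMap 0 r θ - z with hη
  set η' : ℝ → ℂ := fun θ => circleMap 0 r θ * Complex.I with hη'
  have dη : ∀ θ, HasDerivAt η (η' θ) θ := fun θ => (hasDerivAt_circleMap 0 r θ).sub_const z
  have cη : Continuous η := (continuous_circleMap 0 r).sub continuous_const
  have cη' : Continuous η' := (continuous_circleMap 0 r).mul continuous_const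
  have nη' : ∀ θ, ‖η' θ‖ = r := fun θ => by simp [hη', abs_of_pos hr]
  have η0 : ∀ θ, η θ ≠ 0 := fun θ h => by
    have : ‖circleMap 0 r θ‖ = r := by simp [abs_of_pos hr]
    rw [sub_eq_zero.1 h] at this
    exact hz.ne this
  have cg : Continuous g := continuous_iff_continuousAt.2 fun x => (hg x).continuousAt
  have chain : ∀ {γ : ℝ → ℂ} {γ' : ℂ} {t : ℝ}, HasDerivAt γ γ' t →
      HasDerivAt (fun s => g (γ s)) (g₁ (γ t) * γ' + g₂ (γ t) * conj γ') t := by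
    intro γ γ' t h
    exact ((hg (γ t)).comp_hasDerivAt t h).congr_deriv (by simp)
  -- Contract the circle linearly to `z`: the integral of `F t` is the Cauchy integral at `t = 1`
  -- and `2πi g(z)` at `t = 0`. Bounding its `t`-derivative avoids any area integral with a singular
  -- kernel.
  set F : ℝ → ℝ → ℂ := fun t θ => g (z + t * η θ) * (η' θ / η θ) with hF
  set F' : ℝ → ℝ → ℂ := fun t θ =>
    (g₁ (z + t * η θ) * η θ + g₂ (z + t * η θ) * conj (η θ)) * (η' θ / η θ) with hF'
  have ck : Continuous fun θ => η' θ / η θ := cη'.div cη η0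
  have cF : Continuous (Function.uncurry F) := by
    refine Continuous.mul ?_ (ck.comp continuous_snd)
    fun_prop
  have cF' : Continuous (Function.uncurry F') := by
    refine Continuous.mul ?_ (ck.comp continuous_snd)
    exact Continuous.add (by fun_prop) (Continuous.mul (by fun_prop)
      (Complex.continuous_conj.comp (by fun_prop)))
  have dF : ∀ t θ, HasDerivAt (fun s => F s θ) (F' t θ) t := by
    intro t θ
    have : HasDerivAt (fun s : ℝ => z + s * η θ) (η θ) t := by
      simpa using ((Complex.ofRealCLM.hasDerivAt (x := t)).mul_const (η θ)).const_add z
    exact (chain this).mul_const _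
  have dI : ∀ t, HasDerivAt (fun s => ∫ θ in (0:ℝ)..2 * Real.pi, F s θ)
      (∫ θ in (0:ℝ)..2 * Real.pi, F' t θ) t := by
    intro t
    obtain ⟨B, hB⟩ := ((isCompact_Icc (a := t - 1) (b := t + 1)).prod
      (isCompact_uIcc (a := (0:ℝ)) (b := 2 * Real.pi))).exists_bound_of_continuousOn
      cF'.continuousOn
    refine (intervalIntegral.hasDerivAt_integral_of_dominated_loc_of_deriv_le (bound := fun _ => B)
      (F' := F') (s := Set.Icc (t - 1) (t + 1))
      (Icc_mem_nhds (by linarith) (by linarith)) ?_ ?_ ?_ ?_ ?_ ?_).2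
    · exact Filter.Eventually.of_forall fun s =>
        (cF.comp (by fun_prop : Continuous fun θ => (s, θ))).aestronglyMeasurable
    · exact (cF.comp (by fun_prop : Continuous fun θ => (t, θ))).intervalIntegrable _ _
    · exact (cF'.comp (by fun_prop : Continuous fun θ => (t, θ))).aestronglyMeasurable
    · exact Filter.Eventually.of_forall fun θ hθ s hs =>
        hB (s, θ) ⟨hs, Set.uIoc_subset_uIcc hθ⟩
    · exact intervalIntegrable_const
    · exact Filter.Eventually.of_forall fun θ _ s _ => dF s θ
  have per : η (2 * Real.pi) = η 0 := by simp [hη, circleMap]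
  -- the holomorphic part is, up to the antiholomorphic one, a total derivative along the circle
  have parts : ∀ t : ℝ, ∫ θ in (0:ℝ)..2 * Real.pi, g₁ (z + t * η θ) * η' θ =
      - ∫ θ in (0:ℝ)..2 * Real.pi, g₂ (z + t * η θ) * conj (η' θ) := by
    intro t
    have i₁ : IntervalIntegrable (fun θ => g₁ (z + t * η θ) * η' θ) volume 0 (2 * Real.pi) :=
      Continuous.intervalIntegrable (by fun_prop) _ _
    have i₂ : IntervalIntegrable (fun θ => g₂ (z + t * η θ) * conj (η' θ)) volume 0
        (2 * Real.pi) :=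
      (Continuous.mul (by fun_prop)
        (Complex.continuous_conj.comp cη')).intervalIntegrable _ _
    rw [eq_neg_iff_add_eq_zero]
    -- The derivative of `g` along the shrunken circle carries a factor `t`, to be cancelled; hence
    -- `t = 0` is treated apart.
    rcases eq_or_ne t 0 with rfl | ht
    · have e₁ : ∫ θ in (0:ℝ)..2 * Real.pi, η' θ = 0 := by
        rw [integral_eq_sub_of_hasDerivAt (fun θ _ => dη θ) (cη'.intervalIntegrable _ _), per,
          sub_self]
      have e₂ : ∫ θ in (0:ℝ)..2 * Real.pi, conj (η' θ) = 0 := by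
        simp only [intervalIntegral, ← map_sub, integral_conj] at e₁ ⊢
        rw [e₁, map_zero]
      simp only [Complex.ofReal_zero, zero_mul, add_zero, intervalIntegral.integral_const_mul,
        e₁, e₂, mul_zero]
    · have d : ∀ θ, HasDerivAt (fun θ => g (z + t * η θ))
          (t * (g₁ (z + t * η θ) * η' θ + g₂ (z + t * η θ) * conj (η' θ))) θ := by
        intro θ
        convert chain (((dη θ).const_mul (t : ℂ)).const_add z) using 1
        simp only [map_mul, Complex.conj_ofReal]
        ring
      have e := integral_eq_sub_of_hasDerivAt (fun θ _ => d θ)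
        ((i₁.add i₂).const_mul (t : ℂ))
      rw [per, sub_self, intervalIntegral.integral_const_mul, integral_add i₁ i₂] at e
      exact (mul_eq_zero.1 e).resolve_left (by exact_mod_cast ht)
  have bound : ∀ t ∈ Set.Ico (0:ℝ) 1, ‖∫ θ in (0:ℝ)..2 * Real.pi, F' t θ‖ ≤
      2 * r * M * (2 * Real.pi) := by
    intro t ht
    have i₁ : IntervalIntegrable (fun θ => g₁ (z + t * η θ) * η' θ) volume 0 (2 * Real.pi) :=
      Continuous.intervalIntegrable (by fun_prop) _ _
    have c₃ : Continuous fun θ => g₂ (z + t * η θ) * conj (η θ) * (η' θ / η θ) :=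
      Continuous.mul (Continuous.mul (by fun_prop) (Complex.continuous_conj.comp cη)) ck
    have c₂ : Continuous fun θ => g₂ (z + t * η θ) * conj (η' θ) :=
      Continuous.mul (by fun_prop) (Complex.continuous_conj.comp cη')
    have e : ∫ θ in (0:ℝ)..2 * Real.pi, F' t θ = ∫ θ in (0:ℝ)..2 * Real.pi,
        (g₂ (z + t * η θ) * conj (η θ) * (η' θ / η θ) - g₂ (z + t * η θ) * conj (η' θ)) := by
      rw [integral_sub (c₃.intervalIntegrable _ _) (c₂.intervalIntegrable _ _), sub_eq_add_neg,
        ← parts, ← integral_add (c₃.intervalIntegrable _ _) i₁]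
      refine integral_congr fun θ _ => ?_
      have := η0 θ
      simp only [hF']
      field_simp
      ring
    rw [e]
    refine (intervalIntegral.norm_integral_le_of_norm_le_const fun θ _ => ?_).trans_eq
      (by rw [sub_zero, abs_of_pos Real.two_pi_pos])
    have hm : ‖g₂ (z + t * η θ)‖ ≤ M := by
      refine hM _ ?_
      -- A convex combination of two points of the disk.
      have : z + t * η θ = (1 - t : ℝ) * z + t * circleMap 0 r θ := by
        simp only [hη]; push_cast; ring
      rw [this]
      refine (norm_add_le _ _).trans ?_
      rw [norm_mul, norm_mul, Complex.norm_real, Complex.norm_real, norm_circleMap_zero,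
        Real.norm_of_nonneg ht.1, Real.norm_of_nonneg (by linarith [ht.2] : 0 ≤ 1 - t),
        abs_of_pos hr]
      nlinarith [ht.1, ht.2]
    -- Each of the two terms has norm at most `r * M`, whence the factor 2; `‖conj η‖` cancels the
    -- singular `‖η‖`.
    refine (norm_sub_le _ _).trans ?_
    have hn := norm_ne_zero_iff.2 (η0 θ)
    rw [norm_mul, norm_mul, norm_mul, norm_div, RCLike.norm_conj, RCLike.norm_conj, nη',
      mul_assoc, mul_div_cancel₀ _ hn]
    nlinarith
  have key := norm_image_sub_le_of_norm_deriv_le_segment_01'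
    (fun t _ => (dI t).hasDerivWithinAt) bound
  have I1 : ∫ θ in (0:ℝ)..2 * Real.pi, F 1 θ = ∮ ζ in C(0, r), (ζ - z)⁻¹ * g ζ := by
    rw [circleIntegral]
    refine integral_congr fun θ _ => ?_
    simp [hF, hη, hη', div_eq_mul_inv]
    ring
  have I0 : ∫ θ in (0:ℝ)..2 * Real.pi, F 0 θ = (2 * Real.pi * Complex.I) * g z := by
    have := circleIntegral.integral_sub_inv_of_mem_ball (c := 0) (R := r) (w := z)
      (by simpa using hz)
    rw [← this, circleIntegral, ← intervalIntegral.integral_mul_const]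
    refine integral_congr fun θ _ => ?_
    simp [hF, hη, hη', div_eq_mul_inv]
    ring
  rw [I1, I0] at key
  have hpi : (2 * Real.pi * Complex.I : ℂ) ≠ 0 := Complex.two_pi_I_ne_zero
  have e : (2 * Real.pi * Complex.I : ℂ)⁻¹ * (∮ ζ in C(0, r), (ζ - z)⁻¹ * g ζ) - g z =
      (2 * Real.pi * Complex.I : ℂ)⁻¹ * ((∮ ζ in C(0, r), (ζ - z)⁻¹ * g ζ) -
        (2 * Real.pi * Complex.I) * g z) := by
    field_simp
  rw [e, norm_mul, norm_inv]
  have hn : ‖(2 * Real.pi * Complex.I : ℂ)‖ = 2 * Real.pi := by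
    simp [abs_of_pos Real.pi_pos]
  rw [hn, inv_mul_le_iff₀ Real.two_pi_pos]
  linarith

/-! ### Polynomials in `z` and `conj z`, and the Cauchy projection in one variable. -/

section MixedPolynomials

open MvPolynomial ComplexConjugate

variable {ι : Type*}

/-- Evaluation of a polynomial in the variables `z i = X (Sum.inl i)` and their conjugates
`X (Sum.inr i)`. -/
def mixedEval (x : ι → ℂ) : MvPolynomial (ι ⊕ ι) ℂ →ₐ[ℂ] ℂ :=
  aeval (Sum.elim x fun i => conj (x i))

@[simp]
theorem mixedEval_C (x : ι → ℂ) (a : ℂ) : mixedEval x (C a) = a :=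
  aeval_C _ a

@[simp]
theorem mixedEval_X_inl (x : ι → ℂ) (i : ι) : mixedEval x (X (Sum.inl i)) = x i :=
  aeval_X _ _

@[simp]
theorem mixedEval_X_inr (x : ι → ℂ) (i : ι) : mixedEval x (X (Sum.inr i)) = conj (x i) :=
  aeval_X _ _

theorem mixedEval_rename_inl (x : ι → ℂ) (p : MvPolynomial ι ℂ) :
    mixedEval x (rename Sum.inl p) = eval x p := by
  rw [mixedEval, aeval_rename, Sum.elim_comp_inl, aeval_eq_eval]

theorem continuous_mixedEval (G : MvPolynomial (ι ⊕ ι) ℂ) :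
    Continuous fun x : ι → ℂ => mixedEval x G := by
  induction G using MvPolynomial.induction_on with
  | C a => simpa using continuous_const
  | add p q hp hq =>
    simp only [map_add]
    exact hp.add hq
  | mul_X p i hp =>
    simp only [map_mul]
    refine hp.mul ?_
    cases i with
    | inl i => simpa using continuous_apply i
    | inr i =>
      simp only [mixedEval_X_inr]
      exact Complex.continuous_conj.comp (continuous_apply i)

/-- The formal derivatives are the Wirtinger derivatives, so antiholomorphic derivatives can be
computed algebraically. -/
theorem hasFDerivAt_mixedEval_update [DecidableEq ι] (x : ι → ℂ) (j : ι)
    (G : MvPolynomial (ι ⊕ ι) ℂ) (ζ : ℂ) :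
    HasFDerivAt (fun ζ => mixedEval (Function.update x j ζ) G)
      (mixedEval (Function.update x j ζ) (pderiv (Sum.inl j) G) • ContinuousLinearMap.id ℝ ℂ +
        mixedEval (Function.update x j ζ) (pderiv (Sum.inr j) G) •
          (Complex.conjCLE : ℂ →L[ℝ] ℂ)) ζ := by
  induction G using MvPolynomial.induction_on with
  | C a =>
    simp only [mixedEval_C]
    exact (hasFDerivAt_const a ζ).congr_fderiv (by ext v; simp)
  | add p q hp hq =>
    simp only [map_add]
    refine (hp.add hq).congr_fderiv ?_
    module
  | mul_X p i hp =>
    have hX : HasFDerivAt (fun ζ => mixedEval (Function.update x j ζ) (X i))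
        (mixedEval (Function.update x j ζ) (pderiv (Sum.inl j) (X i)) •
          ContinuousLinearMap.id ℝ ℂ +
        mixedEval (Function.update x j ζ) (pderiv (Sum.inr j) (X i)) •
          (Complex.conjCLE : ℂ →L[ℝ] ℂ)) ζ := by
      rcases i with i | i <;> rcases eq_or_ne i j with rfl | hij
      · simp only [mixedEval_X_inl, Function.update_self]
        exact (hasFDerivAt_id ζ).congr_fderiv (by ext v; simp [pderiv_X])
      · simp only [mixedEval_X_inl, Function.update_of_ne hij]
        exact (hasFDerivAt_const (x i) ζ).congr_fderiv
          (by ext v; simp [pderiv_X, hij.symm])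
      · simp only [mixedEval_X_inr, Function.update_self]
        exact ((Complex.conjCLE : ℂ →L[ℝ] ℂ).hasFDerivAt (x := ζ)).congr_fderiv
          (by ext v; simp [pderiv_X])
      · simp only [mixedEval_X_inr, Function.update_of_ne hij]
        exact (hasFDerivAt_const (conj (x i)) ζ).congr_fderiv
          (by ext v; simp [pderiv_X, hij.symm])
    simp only [map_mul]
    refine (hp.mul hX).congr_fderiv ?_
    ext v
    simp
    ring

/-- The image of `z ^ a * conj z ^ b` under the Cauchy projection of the circle of radius `r`. -/
def cauchyProjTerm (j : ι) (r : ℝ) (a b : ℕ) : MvPolynomial (ι ⊕ ι) ℂ :=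
  if b ≤ a then C ((r : ℂ) ^ (2 * b)) * X (Sum.inl j) ^ (a - b) else 0

/-- The Cauchy projection in the variable `z j`: the Cauchy integral over the circle of
radius `r` of a polynomial in the variables and their conjugates. -/
def cauchyProj (j : ι) (r : ℝ) : MvPolynomial (ι ⊕ ι) ℂ →ₗ[ℂ] MvPolynomial (ι ⊕ ι) ℂ :=
  (basisMonomials (ι ⊕ ι) ℂ).constr ℂ fun s =>
    monomial ((s.erase (Sum.inl j)).erase (Sum.inr j)) 1 *
      cauchyProjTerm j r (s (Sum.inl j)) (s (Sum.inr j))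

theorem cauchyProj_monomial (j : ι) (r : ℝ) (s : ι ⊕ ι →₀ ℕ) (c : ℂ) :
    cauchyProj j r (monomial s c) = monomial ((s.erase (Sum.inl j)).erase (Sum.inr j)) c *
      cauchyProjTerm j r (s (Sum.inl j)) (s (Sum.inr j)) := by
  have h : monomial s c = c • basisMonomials (ι ⊕ ι) ℂ s := by
    simp [smul_monomial]
  rw [h, map_smul, cauchyProj, Module.Basis.constr_basis, ← smul_mul_assoc, smul_monomial,
    smul_eq_mul, mul_one]

theorem exists_monomial_eq_mul (j : ι) (s : ι ⊕ ι →₀ ℕ) : ∃ (u : ι ⊕ ι →₀ ℕ) (a b : ℕ),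
    u (Sum.inl j) = 0 ∧ u (Sum.inr j) = 0 ∧
      s = u + Finsupp.single (Sum.inl j) a + Finsupp.single (Sum.inr j) b := by
  classical
  refine ⟨(s.erase (Sum.inl j)).erase (Sum.inr j), s (Sum.inl j), s (Sum.inr j), ?_, ?_, ?_⟩
  · simp [Finsupp.erase_ne]
  · simp
  · ext i
    by_cases h₁ : i = Sum.inl j
    · subst h₁; simp [Finsupp.erase_ne]
    · by_cases h₂ : i = Sum.inr j
      · subst h₂; simp
      · simp [Finsupp.erase_ne, h₁, h₂]

theorem monomial_add_single_add_single (i j : ι ⊕ ι) (u : ι ⊕ ι →₀ ℕ) (a b : ℕ) (c : ℂ) :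
    monomial (u + Finsupp.single i a + Finsupp.single j b) c =
      monomial u c * (X i ^ a * X j ^ b) := by
  rw [X_pow_eq_monomial, X_pow_eq_monomial, monomial_mul, monomial_mul, mul_one, mul_one,
    add_assoc]

theorem cauchyProj_monomial_mul (j : ι) (r : ℝ) {u : ι ⊕ ι →₀ ℕ} (h₁ : u (Sum.inl j) = 0)
    (h₂ : u (Sum.inr j) = 0) (a b : ℕ) (c : ℂ) :
    cauchyProj j r (monomial u c * (X (Sum.inl j) ^ a * X (Sum.inr j) ^ b)) =
      monomial u c * cauchyProjTerm j r a b := by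
  classical
  rw [← monomial_add_single_add_single, cauchyProj_monomial]
  congr 2
  · congr 1
    ext i
    by_cases h₃ : i = Sum.inl j
    · subst h₃; simp [Finsupp.erase_ne, h₁]
    · by_cases h₄ : i = Sum.inr j
      · subst h₄; simp [h₂]
      · simp [Finsupp.erase_ne, h₃, h₄]
  · simp [h₁]
  · simp [h₂]

/-- By linearity it suffices to treat a monomial free of `z j` and `conj z j` times powers of these
two; the projection acts on the powers only. -/
theorem induction_on_coordinate (j : ι) {P : MvPolynomial (ι ⊕ ι) ℂ → Prop}
    (G : MvPolynomial (ι ⊕ ι) ℂ) (h : ∀ (u : ι ⊕ ι →₀ ℕ) (c : ℂ) (a b : ℕ),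
      u (Sum.inl j) = 0 → u (Sum.inr j) = 0 →
        P (monomial u c * (X (Sum.inl j) ^ a * X (Sum.inr j) ^ b)))
    (hadd : ∀ p q, P p → P q → P (p + q)) : P G := by
  induction G using MvPolynomial.induction_on' with
  | monomial s c =>
    obtain ⟨u, a, b, h₁, h₂, rfl⟩ := exists_monomial_eq_mul j s
    rw [monomial_add_single_add_single]
    exact h u c a b h₁ h₂
  | add p q hp hq => exact hadd p q hp hq

theorem pderiv_cauchyProjTerm (i : ι ⊕ ι) (j : ι) (hi : i ≠ Sum.inl j) (r : ℝ) (a b : ℕ) :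
    pderiv i (cauchyProjTerm j r a b) = 0 := by
  unfold cauchyProjTerm
  split_ifs
  · rw [pderiv_C_mul, pderiv_pow, pderiv_X_of_ne hi.symm, mul_zero, mul_zero]
  · exact map_zero _

theorem pderiv_inr_cauchyProj_self (j : ι) (r : ℝ) (G : MvPolynomial (ι ⊕ ι) ℂ) :
    pderiv (Sum.inr j) (cauchyProj j r G) = 0 := by
  induction G using induction_on_coordinate j with
  | h u c a b h₁ h₂ =>
    rw [cauchyProj_monomial_mul j r h₁ h₂, pderiv_mul, pderiv_monomial, h₂,
      pderiv_cauchyProjTerm _ _ (by simp)]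
    simp
  | hadd p q hp hq => rw [map_add, map_add, hp, hq, add_zero]

/-- The other variables are parameters of the projection. -/
theorem pderiv_inr_cauchyProj {i j : ι} (hij : i ≠ j) (r : ℝ) (G : MvPolynomial (ι ⊕ ι) ℂ) :
    pderiv (Sum.inr i) (cauchyProj j r G) = cauchyProj j r (pderiv (Sum.inr i) G) := by
  induction G using induction_on_coordinate j with
  | h u c a b h₁ h₂ =>
    have hX : pderiv (Sum.inr i) (X (Sum.inl j) ^ a * X (Sum.inr j) ^ b :
        MvPolynomial (ι ⊕ ι) ℂ) = 0 := by
      rw [pderiv_mul, pderiv_pow, pderiv_pow, pderiv_X_of_ne (by simp),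
        pderiv_X_of_ne (by simpa using hij.symm)]
      simp
    rw [cauchyProj_monomial_mul j r h₁ h₂, pderiv_mul, pderiv_mul, hX,
      pderiv_cauchyProjTerm _ _ (by simp), mul_zero, add_zero, add_zero,
      pderiv_monomial, cauchyProj_monomial_mul]
    · simp [h₁]
    · simp [h₂]
  | hadd p q hp hq => rw [map_add, map_add, map_add, map_add, hp, hq]

/-- Follows recursively from `ζ⁻ᵏ/(ζ - z) = ζ⁻ᵏ⁻¹ + z ζ⁻ᵏ⁻¹/(ζ - z)`, after division by `z`; the
case `z = 0` is direct. -/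
theorem circleIntegral_sub_inv_mul_zpow_neg {r : ℝ} {z : ℂ} (hz : ‖z‖ < r) (k : ℕ) :
    ∮ ζ in C(0, r), (ζ - z)⁻¹ * (ζ ^ (k + 1))⁻¹ = 0 := by
  have hr : 0 < r := (norm_nonneg z).trans_lt hz
  have n0 : ∀ ζ ∈ Metric.sphere (0 : ℂ) r, ζ ≠ 0 := fun ζ hζ h => by
    simp [h, hr.ne] at hζ
  have nz : ∀ ζ ∈ Metric.sphere (0 : ℂ) r, ζ - z ≠ 0 := fun ζ hζ h => by
    rw [sub_eq_zero.1 h, mem_sphere_zero_iff_norm] at hζ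
    exact hz.ne hζ
  have ci : ∀ k : ℕ, CircleIntegrable (fun ζ => (ζ - z)⁻¹ * (ζ ^ k)⁻¹) 0 r := fun k =>
    ContinuousOn.circleIntegrable hr.le
      (((continuous_id.sub continuous_const).continuousOn.inv₀ nz).mul
        ((continuous_pow k).continuousOn.inv₀ fun ζ hζ => pow_ne_zero _ (n0 ζ hζ)))
  have ci' : ∀ k : ℕ, CircleIntegrable (fun ζ : ℂ => (ζ ^ k)⁻¹) 0 r := fun k =>
    ContinuousOn.circleIntegrable hr.le
      ((continuous_pow k).continuousOn.inv₀ fun ζ hζ => pow_ne_zero _ (n0 ζ hζ))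
  have step : ∀ k : ℕ, ∮ ζ in C(0, r), (ζ - z)⁻¹ * (ζ ^ k)⁻¹ =
      (∮ ζ in C(0, r), (ζ ^ (k + 1))⁻¹) +
        z * ∮ ζ in C(0, r), (ζ - z)⁻¹ * (ζ ^ (k + 1))⁻¹ := by
    intro k
    have cz : CircleIntegrable (fun ζ => z * ((ζ - z)⁻¹ * (ζ ^ (k + 1))⁻¹)) 0 r :=
      (ci (k + 1)).const_smul (a := z)
    rw [← circleIntegral.integral_const_mul, ← circleIntegral.integral_add (ci' _) cz]
    refine circleIntegral.integral_congr hr.le fun ζ hζ => ?_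
    have := n0 ζ hζ
    have := nz ζ hζ
    field_simp
    ring
  have pw : ∀ k : ℕ, ∮ ζ in C(0, r), ((ζ : ℂ) ^ (k + 2))⁻¹ = 0 := by
    intro k
    have := circleIntegral.integral_sub_zpow_of_ne (n := -((k + 2 : ℕ) : ℤ)) (by omega) 0 0 r
    simpa only [sub_zero, zpow_neg, zpow_natCast] using this
  rcases eq_or_ne z 0 with rfl | hz0
  · refine Eq.trans ?_ (pw k)
    refine circleIntegral.integral_congr hr.le fun ζ hζ => ?_
    have := n0 ζ hζ
    simp only [sub_zero]
    field_simp
    ring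
  · induction k with
    | zero =>
      have h := step 0
      have e₁ : ∮ ζ in C(0, r), (ζ - z)⁻¹ * ((ζ : ℂ) ^ 0)⁻¹ = 2 * Real.pi * Complex.I := by
        simpa using circleIntegral.integral_sub_inv_of_mem_ball (c := 0) (R := r) (w := z)
          (by simpa using hz)
      have e₂ : ∮ ζ in C(0, r), ((ζ : ℂ) ^ (0 + 1))⁻¹ = 2 * Real.pi * Complex.I := by
        simpa using circleIntegral.integral_sub_inv_of_mem_ball (c := 0) (R := r) (w := 0)
          (by simpa using hr)
      rw [e₁, e₂] at h
      exact (mul_eq_zero.1 (left_eq_add.1 h)).resolve_left hz0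
    | succ k ih =>
      have h := step (k + 1)
      rw [ih, pw, zero_add] at h
      exact (mul_eq_zero.1 h.symm).resolve_left hz0

/-- On the circle `conj ζ = r²/ζ`, so the integrand involves a single power of `ζ`: nonnegative
powers are reproduced, negative ones killed. -/
theorem circleIntegral_sub_inv_mul_pow_mul_conj_pow {r : ℝ} {z : ℂ} (hz : ‖z‖ < r) (a b : ℕ) :
    ∮ ζ in C(0, r), (ζ - z)⁻¹ * (ζ ^ a * conj ζ ^ b) =
      2 * Real.pi * Complex.I * if b ≤ a then (r : ℂ) ^ (2 * b) * z ^ (a - b) else 0 := by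
  have hr : 0 < r := (norm_nonneg z).trans_lt hz
  have hc : ∀ ζ ∈ Metric.sphere (0 : ℂ) r, ζ ≠ 0 ∧ ζ * conj ζ = (r : ℂ) ^ 2 := by
    intro ζ hζ
    rw [mem_sphere_zero_iff_norm] at hζ
    refine ⟨fun h => by simp [h, hr.ne] at hζ, ?_⟩
    rw [Complex.mul_conj, Complex.normSq_eq_norm_sq, hζ, Complex.ofReal_pow]
  split_ifs with hab
  · obtain ⟨d, rfl⟩ := Nat.exists_eq_add_of_le hab
    have hd : DifferentiableOn ℂ (fun ζ : ℂ => (r : ℂ) ^ (2 * b) * ζ ^ d)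
        (Metric.closedBall 0 r) := by fun_prop
    have := DifferentiableOn.circleIntegral_sub_inv_smul hd (w := z) (by simpa using hz)
    simp only [smul_eq_mul] at this
    rw [add_tsub_cancel_left, ← this]
    refine circleIntegral.integral_congr hr.le fun ζ hζ => ?_
    rw [pow_mul, ← (hc ζ hζ).2]
    ring
  · obtain ⟨d, rfl⟩ := Nat.exists_eq_add_of_lt (not_le.1 hab)
    have h := congrArg (fun w => (r : ℂ) ^ (2 * (a + d + 1)) * w)
      (circleIntegral_sub_inv_mul_zpow_neg hz d)
    simp only [mul_zero, ← circleIntegral.integral_const_mul] at h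
    rw [mul_zero]
    refine Eq.trans ?_ h
    refine circleIntegral.integral_congr hr.le fun ζ hζ => ?_
    have := (hc ζ hζ).1
    rw [pow_mul, ← (hc ζ hζ).2, mul_pow,
      show ζ ^ (a + d + 1) = ζ ^ a * ζ ^ (d + 1) by ring]
    field_simp

theorem mixedEval_monomial_update [DecidableEq ι] (x : ι → ℂ) (j : ι) (ζ : ℂ)
    {u : ι ⊕ ι →₀ ℕ} (h₁ : u (Sum.inl j) = 0) (h₂ : u (Sum.inr j) = 0) (c : ℂ) :
    mixedEval (Function.update x j ζ) (monomial u c) = mixedEval x (monomial u c) := by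
  rw [mixedEval, mixedEval, aeval_monomial, aeval_monomial]
  congr 1
  refine Finsupp.prod_congr fun i hi => ?_
  have hi' := Finsupp.mem_support_iff.1 hi
  rcases i with i | i
  · have : i ≠ j := fun h => hi' (h ▸ h₁)
    simp [this]
  · have : i ≠ j := fun h => hi' (h ▸ h₂)
    simp [this]

/-- Ties the algebraic projection to the integral, inside the disk where the integral is regular. -/
theorem mixedEval_cauchyProj [DecidableEq ι] (x : ι → ℂ) (j : ι) {r : ℝ} (hx : ‖x j‖ < r)
    (G : MvPolynomial (ι ⊕ ι) ℂ) :
    mixedEval x (cauchyProj j r G) = (2 * Real.pi * Complex.I : ℂ)⁻¹ *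
      ∮ ζ in C(0, r), (ζ - x j)⁻¹ * mixedEval (Function.update x j ζ) G := by
  have hr : 0 < r := (norm_nonneg _).trans_lt hx
  have nz : ∀ ζ ∈ Metric.sphere (0 : ℂ) r, ζ - x j ≠ 0 := fun ζ hζ h => by
    rw [sub_eq_zero.1 h, mem_sphere_zero_iff_norm] at hζ
    exact hx.ne hζ
  have ci : ∀ G, CircleIntegrable
      (fun ζ => (ζ - x j)⁻¹ * mixedEval (Function.update x j ζ) G) 0 r := fun G =>
    ContinuousOn.circleIntegrable hr.le
      (((continuous_id.sub continuous_const).continuousOn.inv₀ nz).mul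
        ((continuous_mixedEval G).comp (continuous_const.update j continuous_id)).continuousOn)
  induction G using induction_on_coordinate j with
  | h u c a b h₁ h₂ =>
    rw [cauchyProj_monomial_mul j r h₁ h₂]
    have e : (fun ζ : ℂ => (ζ - x j)⁻¹ * mixedEval (Function.update x j ζ)
        (monomial u c * (X (Sum.inl j) ^ a * X (Sum.inr j) ^ b))) = fun ζ =>
        mixedEval x (monomial u c) * ((ζ - x j)⁻¹ * (ζ ^ a * conj ζ ^ b)) := by
      ext ζ
      rw [map_mul, mixedEval_monomial_update x j ζ h₁ h₂]
      simp
      ring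
    rw [e, circleIntegral.integral_const_mul, circleIntegral_sub_inv_mul_pow_mul_conj_pow hx,
      map_mul, mul_left_comm, inv_mul_cancel_left₀ Complex.two_pi_I_ne_zero]
    congr 1
    unfold cauchyProjTerm
    split_ifs <;> simp
  | hadd p q hp hq =>
    rw [map_add, map_add, hp, hq, ← mul_add, ← circleIntegral.integral_add (ci p) (ci q)]
    simp only [map_add, mul_add]

theorem norm_mixedEval_cauchyProj_sub_le [DecidableEq ι] (x : ι → ℂ) (j : ι) {r M : ℝ}
    (hr : 0 < r) (hx : ‖x j‖ ≤ r) (G : MvPolynomial (ι ⊕ ι) ℂ)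
    (hM : ∀ ζ : ℂ, ‖ζ‖ ≤ r →
      ‖mixedEval (Function.update x j ζ) (pderiv (Sum.inr j) G)‖ ≤ M) :
    ‖mixedEval x (cauchyProj j r G) - mixedEval x G‖ ≤ 2 * r * M := by
  have cu : Continuous fun ζ : ℂ => Function.update x j ζ := continuous_const.update j continuous_id
  have open_case : ∀ z : ℂ, ‖z‖ < r → ‖mixedEval (Function.update x j z) (cauchyProj j r G) -
      mixedEval (Function.update x j z) G‖ ≤ 2 * r * M := by
    intro z hz
    rw [mixedEval_cauchyProj _ j (by simpa using hz)]
    simp only [Function.update_self, Function.update_idem]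
    exact norm_cauchyIntegral_sub_le_of_lt
      ((continuous_mixedEval (pderiv (Sum.inl j) G)).comp cu)
      ((continuous_mixedEval (pderiv (Sum.inr j) G)).comp cu)
      (hasFDerivAt_mixedEval_update x j G) hz hM
  -- Both sides of the difference are polynomial, so the estimate extends to the boundary by
  -- continuity.
  have hcl : x j ∈ closure (Metric.ball (0 : ℂ) r) := by
    rw [closure_ball _ hr.ne']
    simpa using hx
  have := closure_minimal (t := {z | ‖mixedEval (Function.update x j z) (cauchyProj j r G) -
      mixedEval (Function.update x j z) G‖ ≤ 2 * r * M})
    (fun z hz => open_case z (by simpa using hz))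
    (isClosed_le (((continuous_mixedEval _).comp cu).sub
      ((continuous_mixedEval _).comp cu)).norm continuous_const) hcl
  simpa using this

end MixedPolynomials

/-! ### Projection in all variables. -/

section IteratedProjection

open MvPolynomial ComplexConjugate

variable {ι : Type*}

/-- The composition of the Cauchy projections in the variables of a list. -/
def iteratedCauchyProj (ρ : ι → ℝ) :
    List ι → MvPolynomial (ι ⊕ ι) ℂ →ₗ[ℂ] MvPolynomial (ι ⊕ ι) ℂ
  | [] => LinearMap.id
  | j :: l => cauchyProj j (ρ j) ∘ₗ iteratedCauchyProj ρ l

theorem pderiv_inr_iteratedCauchyProj (ρ : ι → ℝ) {i : ι} {l : List ι} (hi : i ∉ l)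
    (G : MvPolynomial (ι ⊕ ι) ℂ) :
    pderiv (Sum.inr i) (iteratedCauchyProj ρ l G) =
      iteratedCauchyProj ρ l (pderiv (Sum.inr i) G) := by
  induction l with
  | nil => rfl
  | cons j l ih =>
    rw [List.mem_cons, not_or] at hi
    simp only [iteratedCauchyProj, LinearMap.comp_apply]
    rw [pderiv_inr_cauchyProj hi.1, ih hi.2]

theorem pderiv_inr_iteratedCauchyProj_of_mem (ρ : ι → ℝ) {i : ι} {l : List ι} (hi : i ∈ l)
    (G : MvPolynomial (ι ⊕ ι) ℂ) :
    pderiv (Sum.inr i) (iteratedCauchyProj ρ l G) = 0 := by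
  induction l with
  | nil => simp at hi
  | cons j l ih =>
    simp only [iteratedCauchyProj, LinearMap.comp_apply]
    rcases eq_or_ne i j with rfl | hij
    · exact pderiv_inr_cauchyProj_self _ _ _
    · rw [pderiv_inr_cauchyProj hij, ih (List.mem_of_ne_of_mem hij hi), map_zero]

/-- In characteristic zero, a monomial containing `conj z i` leaves a nonzero term in the
derivative. -/
theorem exists_rename_inl_eq {G : MvPolynomial (ι ⊕ ι) ℂ}
    (hG : ∀ i, pderiv (Sum.inr i) G = 0) : ∃ q : MvPolynomial ι ℂ, rename Sum.inl q = G := by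
  classical
  refine exists_rename_eq_of_vars_subset_range G Sum.inl Sum.inl_injective ?_
  rintro (i | i) hi
  · exact ⟨i, rfl⟩
  · obtain ⟨s, hs, his⟩ := (mem_vars_iff_mem_support _).1 hi
    have hs' : s = (s - Finsupp.single (Sum.inr i) 1) + Finsupp.single (Sum.inr i) 1 := by
      refine (tsub_add_cancel_of_le ?_).symm
      rw [Finsupp.single_le_iff]
      exact Nat.one_le_iff_ne_zero.2 (Finsupp.mem_support_iff.1 his)
    have h := coeff_pderiv (i := Sum.inr i) G (s - Finsupp.single (Sum.inr i) 1)
    rw [hG, coeff_zero, ← hs'] at h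
    rcases mul_eq_zero.1 h.symm with h | h
    · exact absurd h (mem_support_iff.1 hs)
    · exact absurd h (Nat.cast_add_one_ne_zero _)

/-- The sequence `G` models `p · h⁽ᵏ⁾(β)`. Projecting in one more variable `j` costs `2 ρ j` times
the `conj z j` derivative; this commutes with the earlier projections and shifts `G` by one, so the
induction hypothesis applies to the shifted sequence. -/
theorem exists_bound_iteratedCauchyProj {ρ : ι → ℝ} (hρ : ∀ i, 0 < ρ i) (b : ι → ℂ)
    {l : List ι} (hl : l.Nodup) :
    ∃ B : ℝ, 0 ≤ B ∧ ∀ (G : ℕ → MvPolynomial (ι ⊕ ι) ℂ) (M : ℝ),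
      (∀ k i, pderiv (Sum.inr i) (G k) = b i • G (k + 1)) →
      (∀ k ≤ l.length, ∀ x : ι → ℂ, (∀ i, ‖x i‖ ≤ ρ i) → ‖mixedEval x (G k)‖ ≤ M) →
      ∀ x : ι → ℂ, (∀ i, ‖x i‖ ≤ ρ i) →
        ‖mixedEval x (iteratedCauchyProj ρ l (G 0))‖ ≤ B * M := by
  classical
  induction l with
  | nil => exact ⟨1, zero_le_one, fun G M _ h x hx => by simpa using! h 0 le_rfl x hx⟩
  | cons j l ih =>
    rw [List.nodup_cons] at hl
    obtain ⟨B, hB, ih⟩ := ih hl.2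
    have := (hρ j).le
    refine ⟨B + 2 * ρ j * (‖b j‖ * B), by positivity, fun G M hG h x hx => ?_⟩
    have h₀ := ih G M hG (fun k hk => h k (hk.trans (by simp))) x hx
    have h₁ := ih (fun k => G (k + 1)) M (fun k => hG (k + 1))
      (fun k hk => h (k + 1) (by simpa using hk))
    have h₂ := norm_mixedEval_cauchyProj_sub_le x j (M := ‖b j‖ * (B * M)) (hρ j) (hx j)
      (iteratedCauchyProj ρ l (G 0)) fun ζ hζ => by
        rw [pderiv_inr_iteratedCauchyProj ρ hl.1, hG, map_smul, map_smul, norm_smul]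
        refine mul_le_mul_of_nonneg_left (h₁ _ fun i => ?_) (norm_nonneg _)
        rcases eq_or_ne i j with rfl | hij
        · simpa using hζ
        · simpa [hij] using hx i
    have h₃ := norm_le_norm_add_norm_sub' (mixedEval x (cauchyProj j (ρ j)
      (iteratedCauchyProj ρ l (G 0)))) (mixedEval x (iteratedCauchyProj ρ l (G 0)))
    calc _ ≤ _ := h₃
      _ ≤ B * M + 2 * ρ j * (‖b j‖ * (B * M)) := add_le_add h₀ h₂
      _ = _ := by ring

/-- Only `G 1, G 2, …` enter the bound. This is essential: `G 0` is not small away from the slab. -/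
theorem exists_bound_iteratedCauchyProj_sub {ρ : ι → ℝ} (hρ : ∀ i, 0 < ρ i) (b : ι → ℂ)
    {l : List ι} (hl : l.Nodup) :
    ∃ B : ℝ, 0 ≤ B ∧ ∀ (G : ℕ → MvPolynomial (ι ⊕ ι) ℂ) (M : ℝ),
      (∀ k i, pderiv (Sum.inr i) (G k) = b i • G (k + 1)) →
      (∀ k < l.length, ∀ x : ι → ℂ, (∀ i, ‖x i‖ ≤ ρ i) → ‖mixedEval x (G (k + 1))‖ ≤ M) →
      ∀ x : ι → ℂ, (∀ i, ‖x i‖ ≤ ρ i) →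
        ‖mixedEval x (iteratedCauchyProj ρ l (G 0)) - mixedEval x (G 0)‖ ≤ B * M := by
  classical
  induction l with
  | nil => exact ⟨0, le_rfl, fun G M _ h x hx => by simp [iteratedCauchyProj]⟩
  | cons j l ih =>
    rw [List.nodup_cons] at hl
    obtain ⟨B, hB, ih⟩ := ih hl.2
    obtain ⟨A, hA, hA'⟩ := exists_bound_iteratedCauchyProj hρ b hl.2
    have := (hρ j).le
    refine ⟨2 * ρ j * (‖b j‖ * A) + B, by positivity, fun G M hG h x hx => ?_⟩
    have h₀ := ih G M hG (fun k hk => h k (hk.trans (by simp))) x hx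
    have h₁ := hA' (fun k => G (k + 1)) M (fun k => hG (k + 1))
      (fun k hk => h k (by simpa using Nat.lt_succ_of_le hk))
    have h₂ := norm_mixedEval_cauchyProj_sub_le x j (M := ‖b j‖ * (A * M)) (hρ j) (hx j)
      (iteratedCauchyProj ρ l (G 0)) fun ζ hζ => by
        rw [pderiv_inr_iteratedCauchyProj ρ hl.1, hG, map_smul, map_smul, norm_smul]
        refine mul_le_mul_of_nonneg_left (h₁ _ fun i => ?_) (norm_nonneg _)
        rcases eq_or_ne i j with rfl | hij
        · simpa using hζ
        · simpa [hij] using hx i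
    calc _ ≤ _ := norm_sub_le_norm_sub_add_norm_sub _
            (mixedEval x (iteratedCauchyProj ρ l (G 0))) _
      _ ≤ 2 * ρ j * (‖b j‖ * (A * M)) + B * M := add_le_add h₂ h₀
      _ = _ := by ring

theorem exists_mixedEval_eq_functional [Fintype ι] (β : (ι → ℂ) →ₗ[ℝ] ℝ) :
    ∃ (ℓ : MvPolynomial (ι ⊕ ι) ℂ) (b : ι → ℂ), (∀ x, mixedEval x ℓ = (β x : ℂ)) ∧
      ∀ i, pderiv (Sum.inr i) ℓ = C (b i) := by
  classical
  -- Chosen so that `β x = ∑ 2 Re (conj (b i) * x i)`.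
  set b : ι → ℂ := fun i =>
    ⟨β (Pi.single i 1) / 2, β (Pi.single i Complex.I) / 2⟩ with hb
  refine ⟨∑ i, (C (conj (b i)) * X (Sum.inl i) + C (b i) * X (Sum.inr i)), b,
    fun x => ?_, fun i => ?_⟩
  · have hx : x = ∑ i, ((x i).re • Pi.single (M := fun _ => ℂ) i 1 +
        (x i).im • Pi.single (M := fun _ => ℂ) i Complex.I) := by
      refine (Finset.univ_sum_single x).symm.trans (Finset.sum_congr rfl fun i _ => ?_)
      rw [← Pi.single_smul', ← Pi.single_smul', ← Pi.single_add]
      congr 1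
      simp
    conv_rhs => rw [hx]
    rw [map_sum, map_sum, Complex.ofReal_sum]
    refine Finset.sum_congr rfl fun i _ => ?_
    simp only [map_add, map_mul, map_smul, smul_eq_mul, mixedEval_C, mixedEval_X_inl,
      mixedEval_X_inr, Complex.ofReal_add, Complex.ofReal_mul]
    apply Complex.ext <;> simp [hb] <;> ring
  · rw [map_sum, Finset.sum_eq_single i]
    · rw [map_add, pderiv_C_mul, pderiv_C_mul, pderiv_X_self, pderiv_X_of_ne (by simp)]
      simp
    · intro j _ hj
      rw [map_add, pderiv_C_mul, pderiv_C_mul, pderiv_X_of_ne (by simp),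
        pderiv_X_of_ne (by simpa using hj)]
      simp
    · simp

theorem pderiv_inr_rename_inl (i : ι) (p : MvPolynomial ι ℂ) :
    pderiv (Sum.inr i) (rename Sum.inl p : MvPolynomial (ι ⊕ ι) ℂ) = 0 := by
  induction p using MvPolynomial.induction_on with
  | C a => simp
  | add p q hp hq => rw [map_add, map_add, hp, hq, add_zero]
  | mul_X p j hp =>
    rw [map_mul, pderiv_mul, hp, rename_X, pderiv_X_of_ne (by simp)]
    simp

end IteratedProjection

/-! ### Approximation with derivatives, and the cutoff. -/

section Approximation

open Polynomial

theorem Polynomial.exists_derivative_eq (p : ℝ[X]) : ∃ q : ℝ[X], derivative q = p := by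
  induction p using Polynomial.induction_on' with
  | add p q hp hq =>
    obtain ⟨p', rfl⟩ := hp
    obtain ⟨q', rfl⟩ := hq
    exact ⟨p' + q', derivative_add⟩
  | monomial n a =>
    refine ⟨monomial (n + 1) (a / (n + 1)), ?_⟩
    rw [derivative_monomial]
    have : (n + 1 : ℝ) ≠ 0 := Nat.cast_add_one_ne_zero n
    simp [this]

/-- Simultaneous polynomial approximation of a function and its derivatives. -/
theorem exists_polynomial_iteratedDeriv_near (d : ℕ) {f : ℝ → ℝ} (hf : ContDiff ℝ d f)
    {L : ℝ} (hL : 0 ≤ L) {δ : ℝ} (hδ : 0 < δ) :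
    ∃ h : ℝ[X], ∀ k ≤ d, ∀ t ∈ Set.Icc (-L) L,
      |(derivative^[k] h).eval t - iteratedDeriv k f t| ≤ δ := by
  induction d generalizing f δ with
  | zero =>
    obtain ⟨h, hh⟩ := exists_polynomial_near_of_continuousOn (-L) L f
      hf.continuous.continuousOn δ hδ
    refine ⟨h, fun k hk t ht => ?_⟩
    obtain rfl := Nat.le_zero.1 hk
    simpa using (hh t ht).le
  | succ d ih =>
    have hf' : ContDiff ℝ d (deriv f) := by
      have : ContDiff ℝ (d + 1) f := by exact_mod_cast hf
      exact (contDiff_succ_iff_deriv.1 this).2.2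
    have hdf : Differentiable ℝ f := hf.differentiable (by simp)
    -- Approximate `f'` and integrate from `-L`, matching values there. The number `2 * L + 1`
    -- exceeds the interval length, and is at least 1 so that the derivatives stay within `δ`.
    obtain ⟨g, hg⟩ := ih hf' (δ := δ / (2 * L + 1)) (by positivity)
    obtain ⟨h, hh⟩ := Polynomial.exists_derivative_eq g
    refine ⟨h + Polynomial.C (f (-L) - h.eval (-L)), fun k hk t ht => ?_⟩
    have hd : derivative (h + Polynomial.C (f (-L) - h.eval (-L))) = g := by simp [hh]
    have hδ' : δ / (2 * L + 1) ≤ δ := div_le_self hδ.le (by linarith)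
    rcases k with _ | k
    · have key := (convex_Icc (-L) L).norm_image_sub_le_of_norm_hasDerivWithin_le
        (f := fun t => (h + Polynomial.C (f (-L) - h.eval (-L))).eval t - f t)
        (f' := fun t => g.eval t - deriv f t) (C := δ / (2 * L + 1))
        (fun t _ => by
          have := ((h + Polynomial.C (f (-L) - h.eval (-L))).hasDerivAt t).sub
            (hdf t).hasDerivAt
          rw [hd] at this
          exact this.hasDerivWithinAt)
        (fun t ht => by simpa using hg 0 (Nat.zero_le _) t ht)
        (Set.left_mem_Icc.2 (by linarith)) ht
      have e : ‖t - -L‖ ≤ 2 * L + 1 := by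
        rw [Real.norm_eq_abs, abs_le]
        constructor <;> linarith [ht.1, ht.2]
      have e₂ : δ / (2 * L + 1) * ‖t - -L‖ ≤ δ := by
        rw [div_mul_eq_mul_div, div_le_iff₀ (by positivity)]
        gcongr
      simpa using key.trans e₂
    · rw [Function.iterate_succ_apply, hd, iteratedDeriv_succ']
      exact (hg k (by omega) t ht).trans hδ'

end Approximation

theorem exists_smooth_cutoff {a b : ℝ} (hab : a < b) :
    ∃ χ : ℝ → ℝ, (∀ d : ℕ, ContDiff ℝ d χ) ∧ (∀ t, 0 ≤ χ t ∧ χ t ≤ 1) ∧ (∀ t ≤ a, χ t = 0) ∧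
      (∀ t, b ≤ t → χ t = 1) ∧
      ∀ (k : ℕ) (t : ℝ), t ∉ Set.Icc a b → iteratedDeriv (k + 1) χ t = 0 := by
  have h₀ : ∀ t ≤ a, Real.smoothTransition ((t - a) / (b - a)) = 0 := fun t ht =>
    Real.smoothTransition.zero_of_nonpos
      (div_nonpos_of_nonpos_of_nonneg (by linarith) (by linarith))
  have h₁ : ∀ t, b ≤ t → Real.smoothTransition ((t - a) / (b - a)) = 1 := fun t ht =>
    Real.smoothTransition.one_of_one_le (by rw [le_div_iff₀ (by linarith)]; linarith)
  refine ⟨fun t => Real.smoothTransition ((t - a) / (b - a)), fun d => ?_,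
    fun t => ⟨Real.smoothTransition.nonneg _, Real.smoothTransition.le_one _⟩, h₀, h₁,
    fun k t ht => ?_⟩
  · exact (Real.smoothTransition.contDiff (n := (d : ℕ∞))).comp (by fun_prop)
  · rw [Set.mem_Icc, not_and_or, not_le, not_le] at ht
    rcases ht with ht | ht
    · have e : (fun t => Real.smoothTransition ((t - a) / (b - a))) =ᶠ[nhds t] fun _ => 0 := by
        filter_upwards [Iio_mem_nhds ht] with s hs using h₀ s hs.le
      rw [e.iteratedDeriv_eq, iteratedDeriv_const]
      simp
    · have e : (fun t => Real.smoothTransition ((t - a) / (b - a))) =ᶠ[nhds t] fun _ => 1 := by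
        filter_upwards [Ioi_mem_nhds ht] with s hs using h₁ s hs.le
      rw [e.iteratedDeriv_eq, iteratedDeriv_const]
      simp

/-! ### Splitting polynomials on a polydisk. -/

theorem isCompact_polydisk {ι : Type*} (ρ : ι → ℝ) :
    IsCompact {x : ι → ℂ | ∀ i, ‖x i‖ ≤ ρ i} := by
  have : {x : ι → ℂ | ∀ i, ‖x i‖ ≤ ρ i} =
      Set.univ.pi fun i => Metric.closedBall (0 : ℂ) (ρ i) := by
    ext x
    simp [Set.mem_pi]
  rw [this]
  exact isCompact_univ_pi fun _ => isCompact_closedBall _ _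

open MvPolynomial in
theorem mixedEval_mul_aeval {ι : Type*} {β : (ι → ℂ) →ₗ[ℝ] ℝ} {ℓ : MvPolynomial (ι ⊕ ι) ℂ}
    (hℓ : ∀ x, mixedEval x ℓ = (β x : ℂ)) (p : MvPolynomial ι ℂ) (h : Polynomial ℝ)
    (x : ι → ℂ) :
    mixedEval x (rename Sum.inl p * Polynomial.aeval ℓ (h.map (algebraMap ℝ ℂ))) =
      eval x p * ((h.eval (β x) : ℝ) : ℂ) := by
  rw [map_mul, mixedEval_rename_inl, ← Polynomial.aeval_algHom_apply, hℓ,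
    Polynomial.aeval_map_algebraMap]
  congr 1
  exact Polynomial.aeval_algebraMap_apply_eq_algebraMap_eval (A := ℂ) (β x) h

open MvPolynomial in
/-- Splitting of a polynomial on a polydisk, along a real linear functional, with bounds in terms
of its size on the slab `a ≤ β ≤ b` only. -/
theorem exists_polynomial_splitting {ι : Type*} [Fintype ι] {ρ : ι → ℝ} (hρ : ∀ i, 0 < ρ i)
    (β : (ι → ℂ) →ₗ[ℝ] ℝ) {a b : ℝ} (hab : a < b) :
    ∃ B : ℝ, 0 < B ∧ ∀ (p : MvPolynomial ι ℂ) (η : ℝ), 0 < η →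
      (∀ x : ι → ℂ, (∀ i, ‖x i‖ ≤ ρ i) → a ≤ β x → β x ≤ b → ‖eval x p‖ ≤ η) →
      ∃ q : MvPolynomial ι ℂ,
        (∀ x : ι → ℂ, (∀ i, ‖x i‖ ≤ ρ i) → β x ≤ b → ‖eval x q‖ ≤ B * η) ∧
        ∀ x : ι → ℂ, (∀ i, ‖x i‖ ≤ ρ i) → a ≤ β x → ‖eval x p - eval x q‖ ≤ B * η := by
  classical
  obtain ⟨ℓ, c, hℓ, hc⟩ := exists_mixedEval_eq_functional β
  obtain ⟨χ, χd, χ01, χ0, χ1, χs⟩ := exists_smooth_cutoff hab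
  set l : List ι := Finset.univ.toList with hl
  obtain ⟨A, hA, hbd⟩ := exists_bound_iteratedCauchyProj_sub hρ c
    (Finset.nodup_toList (Finset.univ : Finset ι))
  have hβ : Continuous β := β.continuous_of_finiteDimensional
  obtain ⟨L, hL⟩ := (isCompact_polydisk ρ).exists_bound_of_continuousOn hβ.continuousOn
  have hL' : ∀ x : ι → ℂ, (∀ i, ‖x i‖ ≤ ρ i) → β x ∈ Set.Icc (-|L|) |L| := fun x hx =>
    abs_le.1 ((hL x hx).trans (le_abs_self L))
  have hD : ∀ k : ℕ, ∃ D : ℝ, ∀ t ∈ Set.Icc (-|L|) |L|, ‖iteratedDeriv k χ t‖ ≤ D := fun k =>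
    isCompact_Icc.exists_bound_of_continuousOn ((χd k).continuous_iteratedDeriv' k).continuousOn
  choose D hD using hD
  set E : ℝ := ∑ k ∈ Finset.range (l.length + 1), |D k| with hE
  have hE0 : 0 ≤ E := Finset.sum_nonneg fun k _ => abs_nonneg _
  have hDE : ∀ k ≤ l.length, ∀ t ∈ Set.Icc (-|L|) |L|, ‖iteratedDeriv k χ t‖ ≤ E :=
    fun k hk t ht => (hD k t ht).trans ((le_abs_self _).trans
      (Finset.single_le_sum (f := fun k => |D k|) (fun k _ => abs_nonneg _)
        (Finset.mem_range.2 (Nat.lt_succ_of_le hk))))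
  -- `A * (E + 1)` pays for the projection, one unit for replacing `χ` by `h`, one for the size of
  -- `p · χ(β)` or `p · (1 - χ(β))`.
  refine ⟨A * (E + 1) + 2, by positivity, fun p η hη hp => ?_⟩
  obtain ⟨N, hN⟩ := (isCompact_polydisk ρ).exists_bound_of_continuousOn
    (MvPolynomial.continuous_eval p).continuousOn
  -- The polynomial `h` may depend on `p`: the tolerance absorbs the size of `p` on the full
  -- polydisk, and `A`, `E` are already fixed.
  obtain ⟨h, hh⟩ := exists_polynomial_iteratedDeriv_near l.length (χd _) (abs_nonneg L)
    (δ := η / (|N| + 1)) (by positivity)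
  have herr : ∀ k ≤ l.length, ∀ x : ι → ℂ, (∀ i, ‖x i‖ ≤ ρ i) → ‖eval x p‖ *
      |(Polynomial.derivative^[k] h).eval (β x) - iteratedDeriv k χ (β x)| ≤ η := by
    intro k hk x hx
    have h₁ : ‖eval x p‖ ≤ |N| + 1 := (hN x hx).trans ((le_abs_self N).trans (by linarith))
    calc _ ≤ (|N| + 1) * (η / (|N| + 1)) :=
          mul_le_mul h₁ (hh k hk _ (hL' x hx)) (abs_nonneg _) (by positivity)
      _ = η := mul_div_cancel₀ _ (by positivity)
  set G : ℕ → MvPolynomial (ι ⊕ ι) ℂ := fun k => rename Sum.inl p *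
    Polynomial.aeval ℓ ((Polynomial.derivative^[k] h).map (algebraMap ℝ ℂ)) with hG
  have evG : ∀ k x, mixedEval x (G k) =
      eval x p * (((Polynomial.derivative^[k] h).eval (β x) : ℝ) : ℂ) := fun k x =>
    mixedEval_mul_aeval hℓ p _ x
  have dG : ∀ k i, pderiv (Sum.inr i) (G k) = c i • G (k + 1) := by
    intro k i
    simp only [hG]
    rw [pderiv_mul, pderiv_inr_rename_inl, Derivation.map_aeval, hc, Polynomial.derivative_map,
      ← Function.iterate_succ_apply' (Polynomial.derivative), smul_eq_mul, MvPolynomial.smul_eq_C_mul]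
    ring
  have bG : ∀ k < l.length, ∀ x : ι → ℂ, (∀ i, ‖x i‖ ≤ ρ i) →
      ‖mixedEval x (G (k + 1))‖ ≤ (E + 1) * η := by
    intro k hk x hx
    rw [evG, norm_mul, Complex.norm_real, Real.norm_eq_abs]
    have h₁ : ‖eval x p‖ * |iteratedDeriv (k + 1) χ (β x)| ≤ E * η := by
      -- On the slab `p` is small; off it the derivatives of `χ` vanish.
      by_cases hs : β x ∈ Set.Icc a b
      · rw [mul_comm]
        exact mul_le_mul (hDE _ hk _ (hL' x hx)) (hp x hx hs.1 hs.2) (norm_nonneg _) hE0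
      · rw [χs k _ hs, abs_zero, mul_zero]
        positivity
    have h₂ := herr (k + 1) hk x hx
    have h₃ := abs_add_le ((Polynomial.derivative^[k + 1] h).eval (β x) -
      iteratedDeriv (k + 1) χ (β x)) (iteratedDeriv (k + 1) χ (β x))
    rw [sub_add_cancel] at h₃
    have h₄ := mul_le_mul_of_nonneg_left h₃ (norm_nonneg (eval x p))
    linarith
  have key := hbd G _ dG bG
  obtain ⟨q, hq⟩ := exists_rename_inl_eq (G := iteratedCauchyProj ρ l (G 0)) fun i =>
    pderiv_inr_iteratedCauchyProj_of_mem ρ (by simp [hl]) _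
  have key' : ∀ x : ι → ℂ, (∀ i, ‖x i‖ ≤ ρ i) →
      ‖eval x q - eval x p * ((h.eval (β x) : ℝ) : ℂ)‖ ≤ A * ((E + 1) * η) := by
    intro x hx
    have := key x hx
    rwa [← hl, ← hq, mixedEval_rename_inl, evG] at this
  have herr₀ : ∀ x : ι → ℂ, (∀ i, ‖x i‖ ≤ ρ i) →
      ‖eval x p * ((h.eval (β x) : ℝ) : ℂ) - eval x p * ((χ (β x) : ℝ) : ℂ)‖ ≤ η := by
    intro x hx
    rw [← mul_sub, ← Complex.ofReal_sub, norm_mul, Complex.norm_real, Real.norm_eq_abs]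
    simpa using herr 0 (Nat.zero_le _) x hx
  refine ⟨q, fun x hx hxb => ?_, fun x hx hxa => ?_⟩
  · have h₁ : ‖eval x p * ((χ (β x) : ℝ) : ℂ)‖ ≤ η := by
      rw [norm_mul, Complex.norm_real, Real.norm_of_nonneg (χ01 _).1]
      rcases le_total a (β x) with hxa | hxa
      · exact (mul_le_of_le_one_right (norm_nonneg _) (χ01 _).2).trans (hp x hx hxa hxb)
      · rw [χ0 _ hxa, mul_zero]
        exact hη.le
    have e : eval x q = (eval x q - eval x p * ((h.eval (β x) : ℝ) : ℂ)) +
        (eval x p * ((h.eval (β x) : ℝ) : ℂ) - eval x p * ((χ (β x) : ℝ) : ℂ)) +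
        eval x p * ((χ (β x) : ℝ) : ℂ) := by ring
    rw [e]
    refine norm_add₃_le.trans ?_
    linarith [key' x hx, herr₀ x hx]
  · have h₁ : ‖eval x p * ((1 - χ (β x) : ℝ) : ℂ)‖ ≤ η := by
      rw [norm_mul, Complex.norm_real, Real.norm_of_nonneg (by linarith [(χ01 (β x)).2])]
      rcases le_total (β x) b with hxb | hxb
      · exact (mul_le_of_le_one_right (norm_nonneg _) (by linarith [(χ01 (β x)).1])).trans
          (hp x hx hxa hxb)
      · rw [χ1 _ hxb, sub_self, mul_zero]
        exact hη.le
    have e : eval x p - eval x q = -(eval x q - eval x p * ((h.eval (β x) : ℝ) : ℂ)) +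
        -(eval x p * ((h.eval (β x) : ℝ) : ℂ) - eval x p * ((χ (β x) : ℝ) : ℂ)) +
        eval x p * ((1 - χ (β x) : ℝ) : ℂ) := by push_cast; ring
    rw [e]
    refine norm_add₃_le.trans ?_
    rw [norm_neg, norm_neg]
    linarith [key' x hx, herr₀ x hx]

/-! ### From polynomials to uniform algebras. -/

section UniformAlgebras

variable {ι : Type*}

/-- The function on `K` given by a polynomial, as an element of `B(K)`. -/
def polyUniform (K : Compacts (ι → ℂ)) (p : MvPolynomial ι ℂ) : uniformAlg K :=
  ⟨MvPolynomial.aeval (coordFn K) p, Subalgebra.le_topologicalClosure _ ⟨p, rfl⟩⟩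

theorem polyUniform_apply (K : Compacts (ι → ℂ)) (p : MvPolynomial ι ℂ) (x : K) :
    (polyUniform K p).1 x = MvPolynomial.eval x.1 p := by
  induction p using MvPolynomial.induction_on with
  | C a => simp [polyUniform]
  | add p q hp hq => simpa [polyUniform] using! congrArg₂ (· + ·) hp hq
  | mul_X p i hp => simpa [polyUniform, coordFn] using! congrArg (· * x.1 i) hp

theorem norm_polyUniform_le (K : Compacts (ι → ℂ)) (p : MvPolynomial ι ℂ) {B : ℝ} (hB : 0 ≤ B)
    (h : ∀ x ∈ K, ‖MvPolynomial.eval x p‖ ≤ B) : ‖polyUniform K p‖ ≤ B := by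
  refine (ContinuousMap.norm_le _ hB).2 fun x => ?_
  exact (congrArg norm (polyUniform_apply K p x)).trans_le (h x.1 x.2)

theorem norm_uniformRestrict_le {K L : Compacts (ι → ℂ)} (h : K ≤ L) (f : uniformAlg L) :
    ‖uniformRestrict h f‖ ≤ ‖f‖ :=
  (ContinuousMap.norm_le _ (norm_nonneg _)).2 fun x => f.1.norm_coe_le_norm ⟨x.1, h x.2⟩

/-- If polynomials split with bounds, then so do all the elements of the uniform algebra. -/
theorem range_uniformRestrict_sup_eq_top {K L₁ L₂ : Compacts (ι → ℂ)} (h₁ : K ≤ L₁)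
    (h₂ : K ≤ L₂) {B : ℝ} (hB : 0 < B)
    (h : ∀ (p : MvPolynomial ι ℂ) (η : ℝ), 0 < η →
      (∀ x ∈ K, ‖MvPolynomial.eval x p‖ ≤ η) →
      ∃ q : MvPolynomial ι ℂ, (∀ x ∈ L₁, ‖MvPolynomial.eval x q‖ ≤ B * η) ∧
        ∀ x ∈ L₂, ‖MvPolynomial.eval x p - MvPolynomial.eval x q‖ ≤ B * η) :
    LinearMap.range (uniformRestrict h₁).toLinearMap ⊔
      LinearMap.range (uniformRestrict h₂).toLinearMap = (⊤ : Submodule ℂ (uniformAlg K)) := by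
  have : CompleteSpace (uniformAlg L₁) :=
    (Subalgebra.isClosed_topologicalClosure _).completeSpace_coe
  have : CompleteSpace (uniformAlg L₂) :=
    (Subalgebra.isClosed_topologicalClosure _).completeSpace_coe
  let T : NormedAddGroupHom (uniformAlg L₁ × uniformAlg L₂) C(K, ℂ) :=
    AddMonoidHom.mkNormedAddGroupHom
      { toFun := fun f => (uniformRestrict h₁ f.1).1 + (uniformRestrict h₂ f.2).1
        map_zero' := by simp
        map_add' := fun f g => by
          simp only [Prod.fst_add, Prod.snd_add, map_add, Subalgebra.coe_add]
          abel } 2 fun f => by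
      refine (norm_add_le _ _).trans ?_
      rw [two_mul]
      exact add_le_add ((norm_uniformRestrict_le h₁ f.1).trans (norm_fst_le f))
        ((norm_uniformRestrict_le h₂ f.2).trans (norm_snd_le f))
  have hT : ∀ f, T f = (uniformRestrict h₁ f.1).1 + (uniformRestrict h₂ f.2).1 := fun _ => rfl
  have surj : T.SurjectiveOnWith (polyFunctions K).toSubmodule.toAddSubgroup B := by
    intro f hf
    obtain ⟨p, hp⟩ := (mem_polyFunctions K f).1 hf
    -- The splitting requires `η > 0`, and `η = ‖f‖` is used.
    rcases eq_or_ne f 0 with rfl | hf0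
    · exact ⟨0, map_zero T, by simp⟩
    obtain ⟨q, hq₁, hq₂⟩ := h p ‖f‖ (norm_pos_iff.2 hf0) fun x hx => by
      rw [← hp ⟨x, hx⟩]
      exact f.norm_coe_le_norm _
    have hBf : 0 ≤ B * ‖f‖ := by positivity
    refine ⟨(polyUniform L₁ q, polyUniform L₂ (p - q)), ?_, ?_⟩
    · rw [hT]
      ext x
      rw [ContinuousMap.add_apply, uniformRestrict_apply, uniformRestrict_apply,
        polyUniform_apply, polyUniform_apply, map_sub, add_sub_cancel, hp]
    · refine max_le (norm_polyUniform_le _ _ hBf hq₁) (norm_polyUniform_le _ _ hBf ?_)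
      simpa only [map_sub] using hq₂
  rw [eq_top_iff]
  rintro f -
  -- Completeness of the two algebras lets controlled preimages of polynomials be summed to a
  -- preimage of any limit.
  obtain ⟨g, hg, -⟩ := controlled_closure_of_complete hB one_pos surj f.1 f.2
  refine Submodule.mem_sup.2 ⟨uniformRestrict h₁ g.1, ⟨g.1, rfl⟩, uniformRestrict h₂ g.2,
    ⟨g.2, rfl⟩, Subtype.ext ?_⟩
  rw [← hg, hT]
  rfl

end UniformAlgebras

end

/-! ### The slabs of the theorem. -/

theorem mainTheorem8 (n k : ℕ) (R : ℝ) (hR : 0 < R) (α : (Fin n → ℂ) →ₗ[ℝ] ℝ) (c : ℝ)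
    (m : ℕ) (hm : 1 ≤ m) :
    LinearMap.range (uniformRestrict
        (inf_le_left : lowerSlab n k R α c m ⊓ upperSlab n k R α c m ≤
          lowerSlab n k R α c m)).toLinearMap ⊔
      LinearMap.range (uniformRestrict
        (inf_le_right : lowerSlab n k R α c m ⊓ upperSlab n k R α c m ≤
          upperSlab n k R α c m)).toLinearMap =
      (⊤ : Submodule ℂ (uniformAlg (lowerSlab n k R α c m ⊓ upperSlab n k R α c m))) := by
  have hm' : (0 : ℝ) < 1 / m := by
    have : (0 : ℝ) < m := by exact_mod_cast hm
    positivity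
  obtain ⟨B, hB, h⟩ := exists_polynomial_splitting
    (ρ := Sum.elim (fun _ : Fin n => R + 1 / (m : ℝ)) fun _ : Fin k => 1 + 1 / (m : ℝ))
    (by rintro (i | i) <;> simp only [Sum.elim_inl, Sum.elim_inr] <;> linarith)
    -- The functional ignores `w`; the slab has width `2 / m > 0`, leaving room for the cutoff.
    (α ∘ₗ LinearMap.funLeft ℝ ℂ Sum.inl) (a := c - 1 / m) (b := c + 1 / m) (by linarith)
  have hmem : ∀ x : Fin n ⊕ Fin k → ℂ, (∀ i, ‖x i‖ ≤
      Sum.elim (fun _ => R + 1 / (m : ℝ)) (fun _ => 1 + 1 / (m : ℝ)) i) ↔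
        x ∈ polydisk n k R m := fun x => Sum.forall
  refine range_uniformRestrict_sup_eq_top _ _ hB fun p η hη hp => ?_
  obtain ⟨q, hq₁, hq₂⟩ := h p η hη fun x hx ha hb =>
    hp x ⟨⟨(hmem x).1 hx, hb⟩, ⟨(hmem x).1 hx, ha⟩⟩
  exact ⟨q, fun x hx => hq₁ x ((hmem x).2 hx.1) hx.2,
    fun x hx => hq₂ x ((hmem x).2 hx.1) hx.2⟩
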